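/- **Corollary 4.3.** Let $k_1,\dots,k_\ell\in\mathbb R$ and let $\mathbb O_k^n$ denote the following model of the $n$-dimensional space form of curvature $k$: $\mathbb R^n$ if $k=0$; the sphere $\{x\in\mathbb R^{n+1}:\langle x,x\rangle=1/k\}$ if $k>0$; the sheet $\{x\in\mathbb L^{n+1}:\langle x,x\rangle=1/k,\ x_0>0\}$ of the hyperboloid in Lorentz space (with $\langle x,y\rangle=-x_0y_0+\sum_{j\ge1}x_jy_j$) if $k<0$. Let $\hat{\mathbb O}=\mathbb O_{k_1}^{n_1}\times\cdots\times\mathbb O_{k_\ell}^{n_\ell}$, contained in the product $\mathbb R^N$ of the ambient spaces of the factors, and let $\pi_i(x_1,\dots,x_\ell)=(0,\dots,0,x_i,0,\dots,0)$. Let $M^m$ be a connected smooth Riemannian manifold and $f:M^m\to\hat{\mathbb O}$ a smooth isometric immersion, with normal bundle $T^\perp M$, second fundamental form $\alpha$ and normal connection $\nabla^\perp$. Define $\mathbf T_i:T^\perp M\to T^\perp M$ by $\mathbf T_i\xi=(\pi_i\xi)^\perp$, where $(\cdot)^\perp$ is the orthogonal projection onto $T^\perp M$, and let $\mathcal V_i=\ker(\mathrm{Id}-\mathbf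 T_i)$. Let $\mathcal N_1(x)=\operatorname{span}\{\alpha(X,Y): X,Y\in T_xM\}$ be the first normal space and $\mathcal N_1^\perp(x)$ its orthogonal complement in $T_x^\perp M$. Fix $i\in\{1,\dots,\ell\}$. Suppose that $\mathcal V_i\cap\mathcal N_1^\perp$ is a smooth vector subbundle of $T^\perp M$ of rank $\bar n$, and that $\nabla^\perp(\mathcal V_i\cap\mathcal N_1^\perp)\subset\mathcal N_1^\perp$, that is, $(\nabla^\perp_X\xi)(x)\in\mathcal N_1^\perp(x)$ for every smooth section $\xi$ of $\mathcal V_i\cap\mathcal N_1^\perp$, every $x\in M$ and every $X\in T_xM$. Then the codimension of $f$ is reduced by $\bar n$ at the $i$-th coordinate: there is a totally geodesic submanifold $\mathbb O_{k_i}^{m_i}\subset\mathbb O_{k_i}^{n_i}$ with $n_i-m_i=\bar n$ such that $$f(M)\subset\mathbb O_{k_1}^{n_1}\times\cdots\times\mathbb O_{k_i}^{m_i}\times\cdots\times\mathbb O_{k_\ell}^{n_\ell}.$$ -/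

import Mathlib

open scoped Manifold ContDiff Topology

noncomputable section

namespace SpaceFormProduct

/-! ### Space forms -/

/-- `ν k = 1` if `k ≠ 0` and `ν 0 = 0`. -/
def nu (k : ℝ) : ℕ := open Classical in if k = 0 then 0 else 1

/-- The vector space `ℝ^{n + ν(k)}` in which the space form of dimension `n` and curvature `k`
is embedded. -/
abbrev Amb (k : ℝ) (n : ℕ) : Type := Fin (n + nu k) → ℝ

/-- The signs of the scalar product of `Amb k n`: all `+1`, except that the sign of the zeroth
coordinate is `-1` when `k < 0`. -/
def sgn (k : ℝ) {d : ℕ} (j : Fin d) : ℝ := open Classical in if k < 0 ∧ j.val = 0 then -1 else 1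

/-- The scalar product of `Amb k n`: Euclidean if `0 ≤ k`, Lorentzian if `k < 0`. -/
def form (k : ℝ) (n : ℕ) : LinearMap.BilinForm ℝ (Amb k n) :=
  LinearMap.mk₂ ℝ (fun x y => ∑ j, sgn k j * x j * y j)
    (by intro x y z; simp only [Pi.add_apply]; rw [← Finset.sum_add_distrib]
        exact Finset.sum_congr rfl fun j _ => by ring)
    (by intro c x y; simp only [Pi.smul_apply, smul_eq_mul]; rw [Finset.mul_sum]
        exact Finset.sum_congr rfl fun j _ => by ring)
    (by intro x y z; simp only [Pi.add_apply]; rw [← Finset.sum_add_distrib]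
        exact Finset.sum_congr rfl fun j _ => by ring)
    (by intro c x y; simp only [Pi.smul_apply, smul_eq_mul]; rw [Finset.mul_sum]
        exact Finset.sum_congr rfl fun j _ => by ring)

/-- The space form of dimension `n` and curvature `k`: the Euclidean space if `k = 0`, the sphere
`⟨x, x⟩ = 1 / k` if `k > 0`, the sheet `x₀ > 0` of the hyperboloid `⟨x, x⟩ = 1 / k` if `k < 0`. -/
def spaceForm (k : ℝ) (n : ℕ) : Set (Amb k n) :=
  {x | (k ≠ 0 → form k n x x = 1 / k) ∧ (k < 0 → ∀ j, j.val = 0 → 0 < x j)}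

/-- The tangent space of the space form at its point `x`, as a subspace of the ambient space. -/
def spaceFormTangent (k : ℝ) (n : ℕ) (x : Amb k n) : Submodule ℝ (Amb k n) where
  carrier := {X | k ≠ 0 → form k n x X = 0}
  add_mem' := by intro a b ha hb h; rw [map_add, ha h, hb h, add_zero]
  zero_mem' := by intro _; exact map_zero _
  smul_mem' := by intro c a ha h; rw [map_smul, ha h, smul_zero]

/-- Geodesics `ℝ → 𝕆ₖⁿ`: smooth curves whose acceleration in the ambient space is orthogonal to
the space form, that is, whose covariant acceleration vanishes. -/
def IsGeodesic (k : ℝ) (n : ℕ) (γ : ℝ → Amb k n) : Prop :=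
  ContDiff ℝ ∞ γ ∧ (∀ t, γ t ∈ spaceForm k n) ∧
    ∀ t, ∀ X ∈ spaceFormTangent k n (γ t), form k n (deriv (deriv γ) t) X = 0

/-- `S` is a totally geodesic submanifold `𝕆ₖᵐ ⊂ 𝕆ₖⁿ`: it is the image of an isometric smooth
embedding `j : 𝕆ₖᵐ → 𝕆ₖⁿ` such that the geodesics of the submanifold are geodesics of `𝕆ₖⁿ`.
The space form `𝕆ₖᵐ` is a closed submanifold of its ambient space, so that the smooth maps on it
are the restrictions of the smooth maps `J` on the ambient space. -/
def IsTotallyGeodesic (k : ℝ) (m n : ℕ) (S : Set (Amb k n)) : Prop :=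
  ∃ J : Amb k m → Amb k n, ContDiff ℝ ∞ J ∧
    Set.MapsTo J (spaceForm k m) (spaceForm k n) ∧
    J '' spaceForm k m = S ∧
    Topology.IsEmbedding ((spaceForm k m).domRestrict J) ∧
    (∀ x ∈ spaceForm k m, ∀ X ∈ spaceFormTangent k m x, ∀ Y ∈ spaceFormTangent k m x,
      form k n (fderiv ℝ J x X) (fderiv ℝ J x Y) = form k m X Y) ∧
    ∀ γ : ℝ → Amb k m, IsGeodesic k m γ → IsGeodesic k n (J ∘ γ)

/-! ### Products of space forms -/

section Product

variable {ℓ : ℕ}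

/-- The ambient space `ℝᴺ` of the product of the space forms of dimensions `n i` and
curvatures `k i`. -/
abbrev ProdAmb (k : Fin ℓ → ℝ) (n : Fin ℓ → ℕ) : Type := ∀ i, Amb (k i) (n i)

variable (k : Fin ℓ → ℝ) (n : Fin ℓ → ℕ)

/-- The scalar product of `ℝᴺ`, the sum of those of the factors. -/
def prodForm : LinearMap.BilinForm ℝ (ProdAmb k n) :=
  ∑ i, (form (k i) (n i)).compl₁₂ (LinearMap.proj i) (LinearMap.proj i)

/-- The product of the space forms, as a subset of `ℝᴺ`. -/
def prodSpaceForm : Set (ProdAmb k n) := {x | ∀ i, x i ∈ spaceForm (k i) (n i)}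

/-- The tangent space of the product of the space forms at its point `x`. -/
def prodTangent (x : ProdAmb k n) : Submodule ℝ (ProdAmb k n) :=
  Submodule.pi Set.univ fun i => spaceFormTangent (k i) (n i) (x i)

/-- The orthogonal projection `π_i (x₁, …, x_ℓ) = (0, …, x_i, …, 0)`. -/
def factorProj (i : Fin ℓ) : ProdAmb k n →ₗ[ℝ] ProdAmb k n :=
  LinearMap.single ℝ (fun j => Amb (k j) (n j)) i ∘ₗ LinearMap.proj i

end Product

/-- The orthogonal projection onto the subspace `W` with respect to the bilinear form `B`, when
`W` and its `B`-orthogonal subspace are complementary (and zero otherwise). -/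
def orthProj {E : Type*} [AddCommGroup E] [Module ℝ E] (B : LinearMap.BilinForm ℝ E)
    (W : Submodule ℝ E) : E →ₗ[ℝ] W :=
  open Classical in
  if h : IsCompl W (B.orthogonal W) then W.projectionOnto (B.orthogonal W) h else 0

/-! ### Isometric immersions in products of space forms -/

section Immersion

variable {ℓ : ℕ} (m : ℕ) {k : Fin ℓ → ℝ} {n : Fin ℓ → ℕ}
  {M : Type*} [TopologicalSpace M] [ChartedSpace (EuclideanSpace ℝ (Fin m)) M]

/-- The differential `f_* : T_pM → ℝᴺ` of a map with values in `ℝᴺ`. -/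
def diff (f : M → ProdAmb k n) (p : M) : TangentSpace (𝓡 m) p →L[ℝ] ProdAmb k n :=
  mfderiv (𝓡 m) 𝓘(ℝ, ProdAmb k n) f p

/-- `f` is an isometric immersion of the Riemannian manifold `(M, g)` in the product of space
forms. The map is seen as a map into `ℝᴺ`. It is an immersion as `g` is positive definite. -/
structure IsIsometricImmersion [IsManifold (𝓡 m) ∞ M]
    (g : Bundle.ContMDiffRiemannianMetric (𝓡 m) ∞ (EuclideanSpace ℝ (Fin m))
      (fun p : M => TangentSpace (𝓡 m) p))
    (f : M → ProdAmb k n) : Prop where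
  smooth : ContMDiff (𝓡 m) 𝓘(ℝ, ProdAmb k n) ∞ f
  mem : ∀ p, f p ∈ prodSpaceForm k n
  isometric : ∀ (p : M) (X Y : TangentSpace (𝓡 m) p),
    prodForm k n (diff m f p X) (diff m f p Y) = g.inner p X Y

variable (f : M → ProdAmb k n)

/-- The normal space `T_p^⊥M` of `f`, the orthogonal complement of `f_* T_pM` in the tangent space
of the product of space forms at `f p`. -/
def normalSpace (p : M) : Submodule ℝ (ProdAmb k n) :=
  prodTangent k n (f p) ⊓ (prodForm k n).orthogonal (LinearMap.range (diff m f p).toLinearMap)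

/-- The orthogonal projection `Z ↦ Z^⊥` of `ℝᴺ` onto the normal space of `f` at `p`. It annihilates
`f_* T_pM` and the normal space of the product of space forms in `ℝᴺ`. -/
def normalPart (p : M) : ProdAmb k n →ₗ[ℝ] normalSpace m f p :=
  orthProj (prodForm k n) (normalSpace m f p)

/-- The tensor `T_i : T_p^⊥M → T_p^⊥M`, `T_i ξ = (π_i ξ)^⊥`. -/
def tensorT (i : Fin ℓ) (p : M) : normalSpace m f p →ₗ[ℝ] normalSpace m f p :=
  normalPart m f p ∘ₗ factorProj k n i ∘ₗ (normalSpace m f p).subtype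

/-- `𝒱_i = ker (Id - T_i)`. -/
def kerIdSubT (i : Fin ℓ) (p : M) : Submodule ℝ (normalSpace m f p) :=
  LinearMap.ker (LinearMap.id - tensorT m f i p)

/-- The second fundamental form `α(X, Y)` of `f` at `p`, the normal part of the derivative of
`f_* Y` in the direction `X`, where `Y` is extended to a neighbourhood of `p` as the field with
constant components in the chart at `p`. In this chart, which also identifies `T_pM` with the
model space, the derivative of `f_* Y` is the second derivative of `f`. -/
def secondFundamentalForm (p : M) (X Y : TangentSpace (𝓡 m) p) : normalSpace m f p :=
  normalPart m f p
    (fderiv ℝ (fderiv ℝ (f ∘ (extChartAt (𝓡 m) p).symm)) (extChartAt (𝓡 m) p p) X Y)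

/-- The first normal space `𝒩₁(p)`, spanned by the values of the second fundamental form. -/
def firstNormalSpace (p : M) : Submodule ℝ (normalSpace m f p) :=
  Submodule.span ℝ {η | ∃ X Y : TangentSpace (𝓡 m) p, η = secondFundamentalForm m f p X Y}

/-- The orthogonal complement `𝒩₁^⊥(p)` of the first normal space in the normal space. -/
def firstNormalSpacePerp (p : M) : Submodule ℝ (normalSpace m f p) :=
  ((prodForm k n).restrict (normalSpace m f p)).orthogonal (firstNormalSpace m f p)

/-- A smooth section of the normal bundle of `f`. -/
def IsSmoothSection (ξ : ∀ p, normalSpace m f p) : Prop :=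
  ContMDiff (𝓡 m) 𝓘(ℝ, ProdAmb k n) ∞ (fun p => (ξ p : ProdAmb k n))

/-- The normal connection `(∇^⊥_X ξ)(p)`, the normal part of the derivative of `ξ` in the
direction `X`. -/
def normalConnection (ξ : ∀ p, normalSpace m f p) (p : M) (X : TangentSpace (𝓡 m) p) :
    normalSpace m f p :=
  normalPart m f p (diff m (fun q => (ξ q : ProdAmb k n)) p X)

/-- The family `L` of subspaces is a smooth vector subbundle of rank `r` of the normal bundle of
`f`: near every point, it has a frame of `r` smooth sections. -/
def IsSubbundle (L : ∀ p, Submodule ℝ (normalSpace m f p)) (r : ℕ) : Prop :=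
  ∀ p : M, ∃ U : Set M, IsOpen U ∧ p ∈ U ∧ ∃ s : Fin r → ∀ q, normalSpace m f q,
    (∀ a, ContMDiffOn (𝓡 m) 𝓘(ℝ, ProdAmb k n) ∞ (fun q => (s a q : ProdAmb k n)) U) ∧
    ∀ q ∈ U, LinearIndependent ℝ (fun a => s a q) ∧
      Submodule.span ℝ (Set.range fun a => s a q) = L q

/-- The codimension of `f` is reduced by `r` at the `i`-th coordinate. -/
def CodimReduced (i : Fin ℓ) (r : ℕ) : Prop :=
  ∃ (m' : ℕ) (S : Set (Amb (k i) (n i))), m' + r = n i ∧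
    IsTotallyGeodesic (k i) m' (n i) S ∧ ∀ p, f p i ∈ S

end Immersion

/-! ### The scalar product is positive definite on the tangent spaces

Hence the orthogonal projections onto the normal spaces are always defined. -/

theorem form_apply (k : ℝ) (n : ℕ) (x y : Amb k n) :
    form k n x y = ∑ j, sgn k j * x j * y j := rfl

theorem form_pos (k : ℝ) (n : ℕ) (x : Amb k n) (hx : x ∈ spaceForm k n) (X : Amb k n)
    (hX : X ∈ spaceFormTangent k n x) (h0 : X ≠ 0) : 0 < form k n X X := by
  obtain ⟨a, ha⟩ : ∃ a, X a ≠ 0 := Function.ne_iff.mp h0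
  rcases le_or_gt 0 k with hk | hk
  · have h1 : ∀ j : Fin (n + nu k), sgn k j = 1 := fun j => if_neg fun h => by linarith [h.1]
    rw [form_apply]
    refine Finset.sum_pos' (fun j _ => ?_) ⟨a, Finset.mem_univ _, ?_⟩
    · rw [h1]; nlinarith [mul_self_nonneg (X j)]
    · rw [h1]; nlinarith [mul_self_pos.mpr ha]
  · have hn : nu k = 1 := if_neg hk.ne
    let z : Fin (n + nu k) := ⟨0, by omega⟩
    have hs : ∀ u v : Amb k n,
        form k n u v = -(u z * v z) + ∑ j ∈ Finset.univ.erase z, u j * v j := by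
      intro u v
      rw [form_apply, ← Finset.add_sum_erase _ _ (Finset.mem_univ z)]
      congr 1
      · rw [show sgn k z = -1 from if_pos ⟨hk, rfl⟩]; ring
      · refine Finset.sum_congr rfl fun j hj => ?_
        rw [show sgn k j = 1 from if_neg fun h => Finset.ne_of_mem_erase hj (Fin.ext h.2)]; ring
    have e1 := hx.1 hk.ne
    have e2 := hX hk.ne
    have e3 : 0 < x z := hx.2 hk z rfl
    have e4 : 1 / k < 0 := one_div_neg.mpr hk
    have cs := Finset.sum_mul_sq_le_sq_mul_sq (Finset.univ.erase z) x X
    rw [hs] at e1 e2 ⊢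
    simp only [← pow_two] at e1 ⊢
    have hB : 0 ≤ ∑ j ∈ Finset.univ.erase z, X j ^ 2 := Finset.sum_nonneg fun j _ => sq_nonneg _
    have e5 : ∑ j ∈ Finset.univ.erase z, x j * X j = x z * X z := by linarith
    rw [e5] at cs
    rcases hB.eq_or_lt with hB | hB
    · exfalso
      rw [← hB, mul_zero] at cs
      have hz : X z = 0 := by
        have := pow_eq_zero_iff (two_ne_zero) |>.mp (le_antisymm cs (sq_nonneg _))
        exact (mul_eq_zero.mp this).resolve_left e3.ne'
      refine ha ?_
      by_cases haz : a = z
      · rw [haz, hz]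
      · have := (Finset.sum_eq_zero_iff_of_nonneg (fun j _ => sq_nonneg (X j))).mp hB.symm a
          (Finset.mem_erase.mpr ⟨haz, Finset.mem_univ _⟩)
        exact pow_eq_zero_iff (two_ne_zero) |>.mp this
    · by_contra hc
      have h6 : ∑ j ∈ Finset.univ.erase z, X j ^ 2 ≤ X z ^ 2 := by linarith
      nlinarith [mul_pos e3 e3, mul_le_mul_of_nonneg_left h6 (sq_nonneg (x z))]

theorem prodForm_pos {ℓ : ℕ} (k : Fin ℓ → ℝ) (n : Fin ℓ → ℕ) (x : ProdAmb k n)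
    (hx : x ∈ prodSpaceForm k n) (X : ProdAmb k n) (hX : X ∈ prodTangent k n x) (h0 : X ≠ 0) :
    0 < prodForm k n X X := by
  obtain ⟨a, ha⟩ : ∃ a, X a ≠ 0 := Function.ne_iff.mp h0
  have e : prodForm k n X X = ∑ i, form (k i) (n i) (X i) (X i) := by
    simp [prodForm, LinearMap.sum_apply]
  have hX' : ∀ i, X i ∈ spaceFormTangent (k i) (n i) (x i) := fun i => hX i (Set.mem_univ i)
  rw [e]
  refine Finset.sum_pos' (fun i _ => ?_) ⟨a, Finset.mem_univ _, form_pos _ _ _ (hx a) _ (hX' a) ha⟩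
  by_cases h : X i = 0
  · rw [h]; simp
  · exact (form_pos _ _ _ (hx i) _ (hX' i) h).le

theorem prodForm_symm {ℓ : ℕ} (k : Fin ℓ → ℝ) (n : Fin ℓ → ℕ) (X Y : ProdAmb k n) :
    prodForm k n X Y = prodForm k n Y X := by
  simp only [prodForm, LinearMap.sum_apply, LinearMap.compl₁₂_apply, form_apply]
  exact Finset.sum_congr rfl fun i _ => Finset.sum_congr rfl fun j _ => by ring

/-- At the points of the product of space forms, the orthogonal projections are never junk. -/
theorem isCompl_normalSpace {ℓ m : ℕ} {k : Fin ℓ → ℝ} {n : Fin ℓ → ℕ}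
    {M : Type*} [TopologicalSpace M] [ChartedSpace (EuclideanSpace ℝ (Fin m)) M]
    (f : M → ProdAmb k n) (p : M) (hp : f p ∈ prodSpaceForm k n) :
    IsCompl (normalSpace m f p) ((prodForm k n).orthogonal (normalSpace m f p)) := by
  rw [LinearMap.BilinForm.isCompl_orthogonal_iff_disjoint
    (fun x y h => by rw [prodForm_symm]; exact h), Submodule.disjoint_def]
  intro X hX hX'
  by_contra h
  exact (prodForm_pos k n _ hp X hX.1 h).ne' (hX' X hX)

end SpaceFormProduct

end

open SpaceFormProduct

/-! ### Vector-valued maps on manifolds -/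

section ManifoldCalculus

variable {m : ℕ} {M : Type*} [TopologicalSpace M] [ChartedSpace (EuclideanSpace ℝ (Fin m)) M]
  {E : Type*} [NormedAddCommGroup E] [NormedSpace ℝ E]

/-! By positivity on the tangent spaces of the product, `𝒱_i` consists of the normal vectors whose
only nonzero component is the `i`-th (`mem_kerIdSubT_iff`). Let `ξ` be a section of `𝒱_i ∩ 𝒩₁^⊥` and
differentiate it in `ℝᴺ`. The derivative again has only an `i`-th component. It is orthogonal to
`f_* TM`, because `⟨ξ, f_* Y⟩ = 0` and `ξ` is orthogonal to the second fundamental form. It is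
tangent to the product: if `k_i ≠ 0`, differentiating `⟨ξ, f⟩ = 0` and using `⟨ξ, f_* X⟩ = 0` gives
`⟨dξ X, f⟩ = 0`. So the derivative is already normal and equals `∇^⊥_X ξ`, which the hypothesis
places in `𝒩₁^⊥`. Thus `𝒱_i ∩ 𝒩₁^⊥` is invariant under differentiation in `ℝᴺ`
(`diff_section_mem_reductionSpace`).

An invariant subbundle of a trivial bundle over a connected manifold is a fixed subspace `Λ`
(`subbundle_eq_of_mfderiv_mem`): in a frame normalized by a fixed linear map `P`, each derivative
lies in the fibre and is killed by `P`, which is injective there.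

For `ξ ∈ Λ` the function `⟨ξ, f⟩` has differential zero, so it is constant
(`prodForm_eq_of_forall_mem_normalSpace`). Hence the `i`-th component of `f` stays in the section of
the space form by an affine subspace orthogonal to `Λ`. This section is totally geodesic of
codimension `dim Λ`: it is the image of a space form under a linear isometry, followed by a
translation when `k_i = 0` (`isTotallyGeodesic_orthogonal`). -/

theorem mfderiv_eq_fderiv_extChartAt {h : M → E} {p : M}
    (hp : MDifferentiableAt (𝓡 m) 𝓘(ℝ, E) h p) :
    (mfderiv (𝓡 m) 𝓘(ℝ, E) h p : EuclideanSpace ℝ (Fin m) →L[ℝ] E) =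
      fderiv ℝ (h ∘ (extChartAt (𝓡 m) p).symm) (extChartAt (𝓡 m) p p) := by
  rw [hp.mfderiv, ModelWithCorners.range_eq_univ, fderivWithin_univ]
  rfl

theorem contMDiffAt_comp_extChartAt_symm [IsManifold (𝓡 m) ∞ M] {h : M → E} {p : M}
    {u : EuclideanSpace ℝ (Fin m)} (hu : u ∈ (extChartAt (𝓡 m) p).target)
    (hh : ContMDiffAt (𝓡 m) 𝓘(ℝ, E) ∞ h ((extChartAt (𝓡 m) p).symm u)) :
    ContDiffAt ℝ ∞ (h ∘ (extChartAt (𝓡 m) p).symm) u := by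
  have h1 : ContMDiffAt 𝓘(ℝ, EuclideanSpace ℝ (Fin m)) (𝓡 m) ∞ (extChartAt (𝓡 m) p).symm u :=
    (contMDiffOn_extChartAt_symm p).contMDiffAt ((isOpen_extChartAt_target p).mem_nhds hu)
  exact contMDiffAt_iff_contDiffAt.1 (hh.comp u h1)

/-- Chain rule at any point of the chart target, not only at the centre. Which `Y` occurs is
irrelevant for its uses, where the differential vanishes or pairs to zero with a given vector on all
of the tangent space. -/
theorem exists_fderiv_comp_extChartAt_symm [IsManifold (𝓡 m) ∞ M] {h : M → E} {p : M}
    {u : EuclideanSpace ℝ (Fin m)} (hu : u ∈ (extChartAt (𝓡 m) p).target)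
    (hh : MDifferentiableAt (𝓡 m) 𝓘(ℝ, E) h ((extChartAt (𝓡 m) p).symm u)) :
    DifferentiableAt ℝ (h ∘ (extChartAt (𝓡 m) p).symm) u ∧
      ∀ X, ∃ Y, fderiv ℝ (h ∘ (extChartAt (𝓡 m) p).symm) u X =
        mfderiv (𝓡 m) 𝓘(ℝ, E) h ((extChartAt (𝓡 m) p).symm u) Y := by
  have h1 : MDifferentiableAt 𝓘(ℝ, EuclideanSpace ℝ (Fin m)) (𝓡 m)
      (extChartAt (𝓡 m) p).symm u :=
    ((contMDiffOn_extChartAt_symm (n := ∞) p).contMDiffAt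
      ((isOpen_extChartAt_target p).mem_nhds hu)).mdifferentiableAt (by simp)
  refine ⟨(hh.comp u h1).differentiableAt,
    fun X => ⟨mfderiv 𝓘(ℝ, EuclideanSpace ℝ (Fin m)) (𝓡 m) (extChartAt (𝓡 m) p).symm u X, ?_⟩⟩
  rw [← mfderiv_eq_fderiv, mfderiv_comp u hh h1]
  rfl

/-- A map whose differential vanishes near a point is constant near this point. -/
theorem eventually_eq_of_eventually_mfderiv_eq_zero [IsManifold (𝓡 m) ∞ M] {h : M → E} {p : M}
    (hp : ∀ᶠ q in 𝓝 p, MDifferentiableAt (𝓡 m) 𝓘(ℝ, E) h q ∧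
      ∀ X, mfderiv (𝓡 m) 𝓘(ℝ, E) h q X = 0) : ∀ᶠ q in 𝓝 p, h q = h p := by
  set φ := extChartAt (𝓡 m) p with hφ
  have h1 : Filter.Tendsto φ.symm (𝓝 (φ p)) (𝓝 p) := by
    have := (continuousAt_extChartAt_symm (I := 𝓡 m) p).tendsto
    rwa [extChartAt_to_inv] at this
  obtain ⟨ε, hε, hb⟩ := Metric.eventually_nhds_iff_ball.1
    ((h1.eventually hp).and (extChartAt_target_mem_nhds (I := 𝓡 m) p))
  have hd : ∀ u ∈ Metric.ball (φ p) ε, DifferentiableAt ℝ (h ∘ φ.symm) u ∧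
      fderiv ℝ (h ∘ φ.symm) u = 0 := by
    intro u hu
    obtain ⟨⟨hm, hz⟩, ht⟩ := hb u hu
    obtain ⟨hd, hX⟩ := exists_fderiv_comp_extChartAt_symm ht hm
    refine ⟨hd, ContinuousLinearMap.ext fun X => ?_⟩
    obtain ⟨Y, hY⟩ := hX X
    rw [hY, hz]; rfl
  filter_upwards [(continuousAt_extChartAt (I := 𝓡 m) p).eventually (Metric.ball_mem_nhds _ hε),
    extChartAt_source_mem_nhds (I := 𝓡 m) p] with q hq hq'
  have := Metric.isOpen_ball.is_const_of_fderiv_eq_zero (f := h ∘ φ.symm)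
    (convex_ball (φ p) ε).isPreconnected (fun u hu => (hd u hu).1.differentiableWithinAt)
    (fun u hu => (hd u hu).2) hq (Metric.mem_ball_self hε)
  rwa [Function.comp_apply, Function.comp_apply, hφ, (extChartAt (𝓡 m) p).left_inv hq',
    extChartAt_to_inv] at this

theorem eq_of_mfderiv_eq_zero [IsManifold (𝓡 m) ∞ M] [PreconnectedSpace M] {h : M → E}
    (hd : MDifferentiable (𝓡 m) 𝓘(ℝ, E) h) (h0 : ∀ q X, mfderiv (𝓡 m) 𝓘(ℝ, E) h q X = 0)
    (p q : M) : h p = h q :=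
  ((IsLocallyConstant.iff_eventually_eq h).2 fun _ =>
    eventually_eq_of_eventually_mfderiv_eq_zero
      (Filter.Eventually.of_forall fun q => ⟨hd q, h0 q⟩)).apply_eq_of_preconnectedSpace p q

/-- A local section of a family of subspaces agrees near a point with a global one. -/
theorem exists_contMDiff_section_eventuallyEq [T2Space M] [IsManifold (𝓡 m) ∞ M]
    (L : M → Submodule ℝ E) {U : Set M} (hU : IsOpen U) {p : M} (hp : p ∈ U) {σ : M → E}
    (hσ : ContMDiffOn (𝓡 m) 𝓘(ℝ, E) ∞ σ U) (hL : ∀ q ∈ U, σ q ∈ L q) :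
    ∃ τ : M → E, ContMDiff (𝓡 m) 𝓘(ℝ, E) ∞ τ ∧ (∀ q, τ q ∈ L q) ∧ τ =ᶠ[𝓝 p] σ := by
  obtain ⟨χ, -, hχ⟩ := (SmoothBumpFunction.nhds_basis_tsupport (I := 𝓡 m) p).mem_iff.1
    (hU.mem_nhds hp)
  -- Cut off by a bump function supported in `U`: outside `U` the value is `0`, which lies in every
  -- subspace.
  refine ⟨fun q => χ q • σ q, contMDiff_of_tsupport fun q hq => ?_, fun q => ?_, ?_⟩
  · have hqU : q ∈ U := hχ (tsupport_smul_subset_left χ σ hq)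
    exact χ.contMDiffAt.smul (hσ.contMDiffAt (hU.mem_nhds hqU))
  · by_cases hq : q ∈ U
    · exact (L q).smul_mem _ (hL q hq)
    · have : χ q = 0 := image_eq_zero_of_notMem_tsupport fun h => hq (hχ h)
      simp [this]
  · filter_upwards [χ.eventuallyEq_one] with q hq
    simp [hq]

/-- A frame near `p` can be normalized by `P (t a q) = e_a` if this holds at `p`. -/
theorem exists_normalized_frame {r : ℕ} {U : Set M} (hU : IsOpen U) {p : M} (hp : p ∈ U)
    {s : Fin r → M → E} (hs : ∀ a, ContMDiffOn (𝓡 m) 𝓘(ℝ, E) ∞ (s a) U)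
    (P : E →L[ℝ] (Fin r → ℝ)) (hP : ∀ a, P (s a p) = Pi.single a 1) :
    ∃ V : Set M, IsOpen V ∧ p ∈ V ∧ V ⊆ U ∧ ∃ t : Fin r → M → E,
      (∀ a, ContMDiffOn (𝓡 m) 𝓘(ℝ, E) ∞ (t a) V) ∧
      (∀ a, ∀ q, t a q ∈ Submodule.span ℝ (Set.range fun b => s b q)) ∧
      (∀ a, ∀ q ∈ V, P (t a q) = Pi.single a 1) ∧
      ∀ q ∈ V, ∀ x ∈ Submodule.span ℝ (Set.range fun b => s b q), P x = 0 → x = 0 := by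
  let R := Fin r → ℝ
  -- `G q` is `P` read in the frame `s`. It is the identity at `p`, hence invertible nearby, and the
  -- normalized frame is `s` composed with its inverse.
  let G : M → (R →L[ℝ] R) := fun q =>
    ∑ a, ContinuousLinearMap.smulRightL ℝ R R (ContinuousLinearMap.proj a) (P (s a q))
  have hGa : ∀ q (v : R), G q v = P (∑ a, v a • s a q) := by
    intro q v
    simp [G]
    rfl
  have hG : ContMDiffOn (𝓡 m) 𝓘(ℝ, R →L[ℝ] R) ∞ G U := by
    have : ∀ a, ContMDiffOn (𝓡 m) 𝓘(ℝ, R →L[ℝ] R) ∞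
        (fun q => ContinuousLinearMap.smulRightL ℝ R R (ContinuousLinearMap.proj a)
          (P (s a q))) U := fun a =>
      (((ContinuousLinearMap.smulRightL ℝ R R (ContinuousLinearMap.proj a)).comp
        P).contMDiff.comp_contMDiffOn (hs a))
    exact contMDiffOn_finsetSum fun a _ => this a
  have hGp : G p = 1 := by
    ext v b
    rw [hGa, map_sum]
    simp [hP, Pi.single_apply]
  have hopen : IsOpen (U ∩ G ⁻¹' {A | IsUnit A}) :=
    hG.continuousOn.isOpen_inter_preimage hU Units.isOpen
  refine ⟨_, hopen, ⟨hp, by simp [hGp]⟩, Set.inter_subset_left,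
    fun b q => ∑ a, (Ring.inverse (G q) (Pi.single b 1)) a • s a q, fun b => ?_, fun b q => ?_,
    fun b q hq => ?_, fun q hq x hx hx0 => ?_⟩
  · have hinv : ContMDiffOn (𝓡 m) 𝓘(ℝ, R →L[ℝ] R) ∞ (fun q => Ring.inverse (G q))
        (U ∩ G ⁻¹' {A | IsUnit A}) := by
      intro q hq
      obtain ⟨u, hu⟩ := hq.2
      have h1 : ContDiffAt ℝ ∞ Ring.inverse (G q) := hu ▸ contDiffAt_ringInverse ℝ u
      exact h1.contMDiffAt.comp_contMDiffWithinAt q ((hG.mono Set.inter_subset_left) q hq)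
    refine contMDiffOn_finsetSum fun a _ => ContMDiffOn.smul (I := 𝓘(ℝ, ℝ)) (f := fun q =>
      (Ring.inverse (G q) (Pi.single b 1)) a) ?_ ((hs a).mono Set.inter_subset_left)
    exact ((ContinuousLinearMap.proj a).comp
      (ContinuousLinearMap.apply ℝ R (Pi.single b 1))).contMDiff.comp_contMDiffOn hinv
  · exact Submodule.sum_mem _ fun a _ => Submodule.smul_mem _ _ (Submodule.subset_span ⟨a, rfl⟩)
  · rw [← hGa, ← mul_apply_eq_comp, Ring.mul_inverse_cancel _ hq.2]
    rfl
  · obtain ⟨c, rfl⟩ := (Submodule.mem_span_range_iff_exists_fun ℝ).1 hx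
    rw [← hGa] at hx0
    have : c = 0 := by
      have h2 : (Ring.inverse (G q) * G q) c = 0 := by
        rw [mul_apply_eq_comp, hx0, map_zero]
      rwa [Ring.inverse_mul_cancel _ hq.2] at h2
    simp [this]

/-- A smooth subbundle of a trivial bundle which is invariant under differentiation is constant. -/
theorem subbundle_eq_of_mfderiv_mem [T2Space M] [PreconnectedSpace M] [IsManifold (𝓡 m) ∞ M]
    [FiniteDimensional ℝ E] {r : ℕ} (L : M → Submodule ℝ E)
    (hL : ∀ p : M, ∃ U : Set M, IsOpen U ∧ p ∈ U ∧ ∃ s : Fin r → M → E,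
      (∀ a, ContMDiffOn (𝓡 m) 𝓘(ℝ, E) ∞ (s a) U) ∧
      ∀ q ∈ U, LinearIndependent ℝ (fun a => s a q) ∧
        Submodule.span ℝ (Set.range fun a => s a q) = L q)
    (hpar : ∀ σ : M → E, ContMDiff (𝓡 m) 𝓘(ℝ, E) ∞ σ → (∀ q, σ q ∈ L q) →
      ∀ q X, mfderiv (𝓡 m) 𝓘(ℝ, E) σ q X ∈ L q) (p q : M) : L p = L q := by
  refine ((IsLocallyConstant.iff_eventually_eq L).2 fun p => ?_).apply_eq_of_preconnectedSpace p q
  obtain ⟨U, hU, hp, s, hs, hspan⟩ := hL p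
  -- `P` is a left inverse of the injective map `v ↦ ∑ v_a s_a(p)`.
  obtain ⟨P, hP⟩ : ∃ P : E →L[ℝ] (Fin r → ℝ), ∀ a, P (s a p) = Pi.single a 1 := by
    obtain ⟨g, hg⟩ := (Fintype.linearCombination ℝ fun a => s a p).exists_leftInverse_of_injective
      (LinearMap.ker_eq_bot.2 (hspan p hp).1.fintypeLinearCombination_injective)
    refine ⟨LinearMap.toContinuousLinearMap g, fun a => ?_⟩
    simpa using LinearMap.congr_fun hg (Pi.single a 1)
  obtain ⟨V, hV, hpV, hVU, t, ht, htL, htP, hker⟩ := exists_normalized_frame hU hp hs P hP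
  have hdt : ∀ a, ∀ q ∈ V, MDifferentiableAt (𝓡 m) 𝓘(ℝ, E) (t a) q ∧
      ∀ X, mfderiv (𝓡 m) 𝓘(ℝ, E) (t a) q X = 0 := by
    intro a q hq
    have hd : MDifferentiableAt (𝓡 m) 𝓘(ℝ, E) (t a) q :=
      ((ht a).contMDiffAt (hV.mem_nhds hq)).mdifferentiableAt (by simp)
    refine ⟨hd, fun X => ?_⟩
    -- Invariance is assumed for global sections only, so the local section `t a` is replaced by a
    -- global one with the same germ at `q`.
    obtain ⟨τ, hτ, hτL, hτt⟩ := exists_contMDiff_section_eventuallyEq L hV hq (ht a)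
      fun y hy => (hspan y (hVU hy)).2 ▸ htL a y
    have h1 : mfderiv (𝓡 m) 𝓘(ℝ, E) (t a) q X ∈ L q := by
      have := hpar τ hτ hτL q X
      rwa [hτt.mfderiv_eq] at this
    rw [← (hspan q (hVU hq)).2] at h1
    refine hker q hq _ h1 ?_
    have hc : P ∘ t a =ᶠ[𝓝 q] fun _ => Pi.single a 1 := by
      filter_upwards [hV.mem_nhds hq] with y hy using htP a y hy
    have h2 := hc.mfderiv_eq (I := 𝓡 m) (I' := 𝓘(ℝ, Fin r → ℝ))
    rw [mfderiv_const, mfderiv_comp q P.mdifferentiableAt hd, P.mfderiv_eq] at h2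
    exact DFunLike.congr_fun h2 X
  have hconst : ∀ᶠ q in 𝓝 p, ∀ a, t a q = t a p :=
    Filter.eventually_all.2 fun a => eventually_eq_of_eventually_mfderiv_eq_zero <| by
      filter_upwards [hV.mem_nhds hpV] with q hq using hdt a q hq
  have hLt : ∀ q ∈ V, L q = Submodule.span ℝ (Set.range fun a => t a q) := by
    intro q hq
    rw [← (hspan q (hVU hq)).2]
    refine le_antisymm (fun x hx => ?_) (Submodule.span_le.2 ?_)
    · have h1 : ∑ a, P x a • t a q ∈ Submodule.span ℝ (Set.range fun a => t a q) :=
        Submodule.sum_mem _ fun a _ => Submodule.smul_mem _ _ (Submodule.subset_span ⟨a, rfl⟩)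
      have h2 : x - ∑ a, P x a • t a q = 0 := by
        refine hker q hq _ (Submodule.sub_mem _ hx <| Submodule.sum_mem _ fun a _ =>
          Submodule.smul_mem _ _ (htL a q)) ?_
        rw [map_sub, map_sum, sub_eq_zero]
        ext b
        simp [htP _ q hq, Pi.single_apply]
      rwa [sub_eq_zero.1 h2]
    · rintro _ ⟨a, rfl⟩
      exact htL a q
  filter_upwards [hconst, hV.mem_nhds hpV] with q hq hqV
  rw [hLt q hqV, hLt p hpV]
  simp only [hq]

end ManifoldCalculus

/-! ### Positive definite bilinear forms -/

/-- A positive definite symmetric bilinear form has an orthonormal basis. -/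
theorem exists_orthonormal_basis_of_posDef {E : Type*} [AddCommGroup E] [Module ℝ E]
    [FiniteDimensional ℝ E] (B : LinearMap.BilinForm ℝ E) (hs : ∀ x y, B x y = B y x)
    (hp : ∀ x, x ≠ 0 → 0 < B x x) :
    ∃ b : Module.Basis (Fin (Module.finrank ℝ E)) ℝ E,
      ∀ i j, B (b i) (b j) = if i = j then 1 else 0 := by
  let core : InnerProductSpace.Core ℝ E :=
    { inner := fun x y => B x y
      conj_inner_symm := fun x y => hs y x
      re_inner_nonneg := fun x => by
        by_cases h : x = 0
        · simp [h]
        · exact (hp x h).le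
      add_left := fun x y z => by simp
      smul_left := fun x y r => by simp
      definite := fun x h => by
        by_contra h0
        exact (hp x h0).ne' h }
  let _ : NormedAddCommGroup E := core.toNormedAddCommGroup
  let _ : InnerProductSpace ℝ E := InnerProductSpace.ofCore core.toCore
  refine ⟨(stdOrthonormalBasis ℝ E).toBasis, fun i j => ?_⟩
  exact (orthonormal_iff_ite.1 (stdOrthonormalBasis ℝ E).orthonormal i j)

/-! ### Totally geodesic sections of a space form -/

namespace SpaceFormProduct

variable {k : ℝ} {n : ℕ}

theorem form_symm (x y : Amb k n) : form k n x y = form k n y x := by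
  simp only [form_apply]
  exact Finset.sum_congr rfl fun j _ => by ring

theorem mem_spaceFormTangent {x X : Amb k n} :
    X ∈ spaceFormTangent k n x ↔ (k ≠ 0 → form k n x X = 0) := Iff.rfl

theorem finrank_spaceFormTangent {x : Amb k n} (hx : x ∈ spaceForm k n) :
    Module.finrank ℝ (spaceFormTangent k n x) = n := by
  by_cases hk : k = 0
  · have : spaceFormTangent k n x = ⊤ := by
      ext X; simp [mem_spaceFormTangent, hk]
    rw [this, finrank_top]
    simp [nu, hk]
  · have h1 : spaceFormTangent k n x = LinearMap.ker (form k n x) := by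
      ext X; simp [mem_spaceFormTangent, hk]
    have h2 : LinearMap.range (form k n x) = ⊤ := by
      refine LinearMap.range_eq_top.2 (LinearMap.surjective fun h => ?_)
      have := hx.1 hk
      rw [h] at this
      simp only [LinearMap.zero_apply] at this
      exact one_div_ne_zero hk this.symm
    have h3 := LinearMap.finrank_range_add_finrank_ker (form k n x)
    rw [h2, finrank_top, ← h1] at h3
    simp [nu, hk] at h3
    omega

/-- Points of the two-sheeted hyperboloid lie in the same sheet as the point `x` of the space form
exactly if their scalar product with `x` is negative. -/
theorem form_neg_iff_zeroth_pos (hk : k < 0) {x y : Amb k n} (hx : x ∈ spaceForm k n)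
    (hy : form k n y y = 1 / k) : form k n y x < 0 ↔ ∀ j, j.val = 0 → 0 < y j := by
  have hn : nu k = 1 := if_neg hk.ne
  let z : Fin (n + nu k) := ⟨0, by omega⟩
  have hs : ∀ u v : Amb k n,
      form k n u v = -(u z * v z) + ∑ j ∈ Finset.univ.erase z, u j * v j := by
    intro u v
    rw [form_apply, ← Finset.add_sum_erase _ _ (Finset.mem_univ z)]
    congr 1
    · rw [show sgn k z = -1 from if_pos ⟨hk, rfl⟩]; ring
    · refine Finset.sum_congr rfl fun j hj => ?_
      rw [show sgn k j = 1 from if_neg fun h => Finset.ne_of_mem_erase hj (Fin.ext h.2)]; ring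
  have e1 := hx.1 hk.ne
  have e3 : 0 < x z := hx.2 hk z rfl
  have e4 : 1 / k < 0 := one_div_neg.mpr hk
  have cs := Finset.sum_mul_sq_le_sq_mul_sq (Finset.univ.erase z) y x
  rw [hs] at e1 hy ⊢
  simp only [← pow_two] at e1 hy
  set A := ∑ j ∈ Finset.univ.erase z, x j ^ 2
  set D := ∑ j ∈ Finset.univ.erase z, y j ^ 2
  set C := ∑ j ∈ Finset.univ.erase z, y j * x j
  have hA : 0 ≤ A := Finset.sum_nonneg fun j _ => sq_nonneg _
  have hD : 0 ≤ D := Finset.sum_nonneg fun j _ => sq_nonneg _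
  -- Both vectors are timelike, so Cauchy–Schwarz on the spatial coordinates makes `-(y z * x z)`
  -- dominate in `⟨y, x⟩` and fix its sign.
  have h1 : C ^ 2 < (y z * x z) ^ 2 := by
    have hA' : A < x z ^ 2 := by linarith
    have hD' : D < y z ^ 2 := by linarith
    calc C ^ 2 ≤ D * A := cs
      _ < y z ^ 2 * x z ^ 2 := mul_lt_mul'' hD' hA' hD hA
      _ = _ := by ring
  have h2 : |C| < |y z * x z| := sq_lt_sq.1 h1
  have h3 : (∀ j : Fin (n + nu k), j.val = 0 → 0 < y j) ↔ 0 < y z :=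
    ⟨fun h => h z rfl, fun h j hj => by rwa [show j = z from Fin.ext hj]⟩
  rw [h3]
  constructor
  · intro h
    by_contra hy0
    have : y z * x z ≤ 0 := mul_nonpos_of_nonpos_of_nonneg (not_lt.1 hy0) e3.le
    rw [abs_of_nonpos this] at h2
    linarith [neg_abs_le C]
  · intro h
    have : 0 < y z * x z := mul_pos h e3
    rw [abs_of_pos this] at h2
    linarith [le_abs_self C]

/-- A subspace `L` of a tangent space of the space form is complementary to its orthogonal
subspace in the ambient space. -/
theorem isCompl_orthogonal_of_le_spaceFormTangent {x₀ : Amb k n} (hx₀ : x₀ ∈ spaceForm k n)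
    {L : Submodule ℝ (Amb k n)} (hL : L ≤ spaceFormTangent k n x₀) :
    IsCompl L ((form k n).orthogonal L) := by
  rw [LinearMap.BilinForm.isCompl_orthogonal_iff_disjoint
    (fun x y h => by rw [form_symm]; exact h), Submodule.disjoint_def]
  intro X hX hX'
  by_contra h
  exact (form_pos k n _ hx₀ X (hL hX) h).ne' (hX' X hX)

/-- Since `L` lies in the tangent space `T`, the modular law gives `L ⊕ (T ⊓ L^⊥) = T`, of dimension
`n`. -/
theorem finrank_inf_orthogonal_add_finrank {x₀ : Amb k n} (hx₀ : x₀ ∈ spaceForm k n)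
    {L : Submodule ℝ (Amb k n)} (hL : L ≤ spaceFormTangent k n x₀) :
    Module.finrank ℝ ↥(spaceFormTangent k n x₀ ⊓ (form k n).orthogonal L) +
      Module.finrank ℝ L = n := by
  have hc := isCompl_orthogonal_of_le_spaceFormTangent hx₀ hL
  rw [← Submodule.finrank_sup_add_finrank_inf_eq, inf_assoc, hc.symm.inf_eq_bot, inf_bot_eq,
    finrank_bot, add_zero, sup_comm, inf_comm, ← sup_inf_assoc_of_le _ hL, hc.sup_eq_top,
    top_inf_eq, finrank_spaceFormTangent hx₀]

/-- A linear isometry of an ambient space onto the orthogonal complement of `L`. -/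
theorem exists_isometry_onto_orthogonal {x₀ : Amb k n} (hx₀ : x₀ ∈ spaceForm k n)
    {L : Submodule ℝ (Amb k n)} (hL : L ≤ spaceFormTangent k n x₀)
    (hLx : k ≠ 0 → x₀ ∈ (form k n).orthogonal L) :
    ∃ m : ℕ, m + Module.finrank ℝ L = n ∧ ∃ A : Amb k m →ₗ[ℝ] Amb k n,
      (∀ x y, form k n (A x) (A y) = form k m x y) ∧
      LinearMap.range A = (form k n).orthogonal L ∧
      (k < 0 → ∃ c > 0, ∀ x, ∀ j, j.val = 0 → form k n (A x) x₀ = -(c * x j)) := by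
  set T := spaceFormTangent k n x₀ ⊓ (form k n).orthogonal L
  set m := Module.finrank ℝ T
  obtain ⟨b, hb⟩ : ∃ b : Module.Basis (Fin m) ℝ T,
      ∀ i j, form k n (b i) (b j) = if i = j then 1 else 0 :=
    exists_orthonormal_basis_of_posDef ((form k n).restrict T)
    (fun x y => form_symm _ _)
    (fun x hx => form_pos k n x₀ hx₀ x x.2.1 (fun h => hx (Subtype.ext h)))
  refine ⟨m, finrank_inf_orthogonal_add_finrank hx₀ hL, ?_⟩
  -- With this factor `⟨c x₀, c x₀⟩ = |k| / k = ±1`, the sign of the zeroth coordinate. So `c x₀`,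
  -- present only if `k ≠ 0`, followed by the orthonormal basis `b` of `T`, has the Gram matrix of
  -- the standard basis of `Amb k m`.
  set c := √|k|
  have hc : c * c = |k| := Real.mul_self_sqrt (abs_nonneg k)
  let e : Fin (m + nu k) → Amb k n := fun j =>
    if h : nu k ≤ j.val then b ⟨j.val - nu k, by omega⟩ else c • x₀
  have hk0 : ∀ j : Fin (m + nu k), ¬ nu k ≤ j.val → k ≠ 0 ∧ j.val = 0 := by
    intro j hj
    by_cases hk : k = 0
    · simp [nu, hk] at hj
    · simp only [nu, hk, if_false] at hj
      exact ⟨hk, by omega⟩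
  have hxT : ∀ t : T, k ≠ 0 → form k n x₀ t = 0 := fun t => t.2.1
  have he : ∀ i j, form k n (e i) (e j) = if i = j then sgn k i else 0 := by
    intro i j
    by_cases hi : nu k ≤ i.val <;> by_cases hj : nu k ≤ j.val
    · have h1 : sgn k i = 1 := if_neg fun h => by
        simp [nu, h.1.ne, h.2] at hi
      simp only [e, hi, hj, dif_pos, h1]
      refine (hb _ _).trans ?_
      by_cases hij : i = j
      · subst hij
        rw [if_pos rfl, if_pos rfl]
      · have hij' : i.val ≠ j.val := fun h => hij (Fin.ext h)
        rw [if_neg hij, if_neg]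
        rw [Fin.mk.injEq]
        omega
    · have hij : i ≠ j := by rintro rfl; exact hj hi
      simp only [e, hi, hj, dif_pos, dif_neg, not_false_iff, map_smul, hij, if_false]
      rw [form_symm, hxT _ (hk0 j hj).1, smul_zero]
    · have hij : i ≠ j := by rintro rfl; exact hi hj
      simp only [e, hi, hj, dif_pos, dif_neg, not_false_iff, map_smul, hij, if_false,
        LinearMap.smul_apply]
      rw [hxT _ (hk0 i hi).1, smul_zero]
    · obtain ⟨hk, hi0⟩ := hk0 i hi
      have hij : i = j := Fin.ext (hi0.trans (hk0 j hj).2.symm)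
      subst hij
      simp only [e, hi, dif_neg, not_false_iff, map_smul, LinearMap.smul_apply, smul_eq_mul,
        if_true]
      rw [hx₀.1 hk, ← mul_assoc, hc]
      rcases lt_or_gt_of_ne hk with h | h
      · rw [abs_of_neg h, show sgn k i = -1 from if_pos ⟨h, hi0⟩]
        field_simp
      · rw [abs_of_pos h, show sgn k i = 1 from if_neg fun h' => absurd h'.1 h.not_gt]
        field_simp
  have hA : ∀ x y, form k n (Fintype.linearCombination ℝ e x) (Fintype.linearCombination ℝ e y) =
      form k m x y := by
    intro x y
    simp only [Fintype.linearCombination_apply, map_sum, map_smul, LinearMap.sum_apply,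
      LinearMap.smul_apply, he, smul_eq_mul, form_apply]
    refine Finset.sum_congr rfl fun j _ => ?_
    simp
    ring
  refine ⟨Fintype.linearCombination ℝ e, hA, ?_, fun hk => ?_⟩
  · rw [Fintype.range_linearCombination]
    have hbe : ∀ t : T, (t : Amb k n) ∈ Submodule.span ℝ (Set.range e) := by
      intro t
      rw [← b.sum_repr t, Submodule.coe_sum]
      refine Submodule.sum_mem _ fun a _ => ?_
      refine Submodule.smul_mem _ _ (Submodule.subset_span ⟨⟨a + nu k, by omega⟩, ?_⟩)
      simp [e]
    refine le_antisymm (Submodule.span_le.2 ?_) fun x hx => ?_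
    · rintro _ ⟨j, rfl⟩
      by_cases hj : nu k ≤ j.val
      · simp only [e, hj, dif_pos]
        exact (b _).2.2
      · simp only [e, hj, dif_neg, not_false_iff]
        exact Submodule.smul_mem _ _ (hLx (hk0 j hj).1)
    · by_cases hk : k = 0
      · exact hbe ⟨x, fun h => absurd hk h, hx⟩
      · have hx₀e : x₀ ∈ Submodule.span ℝ (Set.range e) := by
          have hc0 : c ≠ 0 := fun h => by
            rw [h, mul_zero] at hc; exact hk (abs_eq_zero.1 hc.symm)
          have : e ⟨0, by simp [nu, hk]⟩ = c • x₀ := by simp [e, nu, hk]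
          rw [← inv_smul_smul₀ hc0 x₀, ← this]
          exact Submodule.smul_mem _ _ (Submodule.subset_span ⟨_, rfl⟩)
        -- Remove the component along `x₀`; the factor `k` is `1 / ⟨x₀, x₀⟩`.
        have ht : x - (k * form k n x₀ x) • x₀ ∈ T := by
          refine ⟨fun _ => ?_, Submodule.sub_mem _ hx (Submodule.smul_mem _ _ (hLx hk))⟩
          rw [map_sub, map_smul, hx₀.1 hk, smul_eq_mul]
          field_simp
          ring
        rw [← sub_add_cancel x ((k * form k n x₀ x) • x₀)]
        exact Submodule.add_mem _ (hbe ⟨_, ht⟩) (Submodule.smul_mem _ _ hx₀e)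
  · have hc0 : 0 < c := Real.sqrt_pos.2 (abs_pos.2 hk.ne)
    refine ⟨c⁻¹, inv_pos.2 hc0, fun x j hj => ?_⟩
    have hj' : ¬ nu k ≤ j.val := by simp [nu, hk.ne, hj]
    -- As `x₀` is `c⁻¹` times the image of the zeroth basis vector, the isometry property computes
    -- `⟨A x, x₀⟩`.
    have h1 : x₀ = c⁻¹ • Fintype.linearCombination ℝ e (Pi.single j 1) := by
      rw [Fintype.linearCombination_apply_single, one_smul]
      simp only [e, hj', dif_neg, not_false_iff]
      rw [inv_smul_smul₀ hc0.ne']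
    conv_lhs => rw [h1]
    rw [map_smul, hA, form_apply, Finset.sum_eq_single j]
    · rw [show sgn k j = -1 from if_pos ⟨hk, hj⟩]
      simp
    · intro i _ hij
      simp [hij]
    · simp

/-- The totally geodesic submanifold of a space form through `x₀` which is orthogonal to `L`. -/
theorem isTotallyGeodesic_orthogonal {x₀ : Amb k n} (hx₀ : x₀ ∈ spaceForm k n)
    {L : Submodule ℝ (Amb k n)} (hL : L ≤ spaceFormTangent k n x₀) :
    ∃ m : ℕ, m + Module.finrank ℝ L = n ∧ IsTotallyGeodesic k m n
      {x | x ∈ spaceForm k n ∧ ∀ ξ ∈ L, form k n ξ x = form k n ξ x₀} := by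
  have hLx : k ≠ 0 → x₀ ∈ (form k n).orthogonal L := fun hk ξ hξ => by
    change form k n ξ x₀ = 0
    rw [form_symm]; exact hL hξ hk
  obtain ⟨m, hm, A, hA, hAr, hA0⟩ := exists_isometry_onto_orthogonal hx₀ hL hLx
  refine ⟨m, hm, ?_⟩
  -- The translation `c` is needed only in the flat case; if `k ≠ 0`, then `x₀` is itself orthogonal
  -- to `L` and the section is linear.
  obtain ⟨c, hc0, hcx⟩ : ∃ c : Amb k n, (k ≠ 0 → c = 0) ∧ x₀ - c ∈ (form k n).orthogonal L := by
    by_cases hk : k = 0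
    · exact ⟨x₀, fun h => absurd hk h, by simp⟩
    · exact ⟨0, fun _ => rfl, by simpa using hLx hk⟩
  let A' : Amb k m →L[ℝ] Amb k n := LinearMap.toContinuousLinearMap A
  have hd : ∀ x, HasFDerivAt (fun x => c + A' x) A' x := fun x => A'.hasFDerivAt.const_add c
  have horth : ∀ y, ∀ ξ ∈ L, form k n ξ (A y) = 0 := fun y ξ hξ =>
    (hAr ▸ LinearMap.mem_range_self A y : A y ∈ (form k n).orthogonal L) ξ hξ
  have hcξ : ∀ ξ ∈ L, form k n ξ c = form k n ξ x₀ := fun ξ hξ => by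
    have h : form k n ξ (x₀ - c) = 0 := hcx ξ hξ
    rw [map_sub] at h; linarith
  -- `A` preserves the sheet: the sign of `⟨A x, x₀⟩` detects it in both hyperboloids.
  have hpos : k < 0 → ∀ x, form k n (A x) (A x) = 1 / k →
      ((∀ j, j.val = 0 → 0 < A x j) ↔ ∀ j, j.val = 0 → 0 < x j) := by
    intro hk x hx
    rw [← form_neg_iff_zeroth_pos hk hx₀ hx]
    obtain ⟨d, hd, hdx⟩ := hA0 hk
    constructor
    · intro h j hj
      rw [hdx x j hj, neg_lt_zero] at h
      exact pos_of_mul_pos_right h hd.le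
    · intro h
      have hz : 0 < m + nu k := by simp [nu, hk.ne]
      rw [hdx x ⟨0, hz⟩ rfl, neg_lt_zero]
      exact mul_pos hd (h _ rfl)
  have hmem : ∀ x, c + A x ∈ spaceForm k n ↔ x ∈ spaceForm k m := by
    intro x
    by_cases hk : k = 0
    · simp [spaceForm, hk]
    · rw [hc0 hk, zero_add]
      simp only [spaceForm, Set.mem_ofPred_eq, hA]
      refine and_congr_right fun h => forall_congr' fun hk' => ?_
      exact hpos hk' x (by rw [hA, h hk])
  have hinj : Function.Injective A := by
    refine LinearMap.ker_eq_bot.1 (LinearMap.ker_eq_bot'.2 fun x hx => ?_)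
    ext j
    have h1 := hA x (Pi.single j 1)
    rw [hx, map_zero, LinearMap.zero_apply, form_apply, Finset.sum_eq_single j] at h1
    · have : sgn k j ≠ 0 := by unfold sgn; split_ifs <;> norm_num
      simpa [this] using h1.symm
    · intro i _ hij
      simp [hij]
    · simp
  refine ⟨fun x => c + A' x, by fun_prop, fun x hx => (hmem x).2 hx, ?_, ?_, ?_, ?_⟩
  · ext y
    constructor
    · rintro ⟨x, hx, rfl⟩
      refine ⟨(hmem x).2 hx, fun ξ hξ => ?_⟩
      rw [map_add, ← hcξ ξ hξ]
      exact add_eq_left.2 (horth x ξ hξ)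
    · rintro ⟨hy, hyL⟩
      have : y - c ∈ LinearMap.range A := by
        rw [hAr]
        intro ξ hξ
        change form k n ξ (y - c) = 0
        rw [map_sub, hyL ξ hξ, hcξ ξ hξ, sub_self]
      obtain ⟨x, hx⟩ := this
      have hxy : c + A x = y := by rw [hx]; abel
      exact ⟨x, (hmem x).1 (hxy ▸ hy), hxy⟩
  · have h1 : Topology.IsEmbedding A' :=
      (LinearMap.isClosedEmbedding_of_injective (LinearMap.ker_eq_bot.2 hinj)).isEmbedding
    have h2 : Topology.IsEmbedding fun x => c + A' x :=
      (Homeomorph.addLeft c).isEmbedding.comp h1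
    exact h2.comp Topology.IsEmbedding.subtypeVal
  · intro x _ X _ Y _
    rw [(hd x).fderiv]
    exact hA X Y
  · rintro γ ⟨hγ, hγm, hγg⟩
    refine ⟨by fun_prop, fun t => (hmem _).2 (hγm t), fun t X hX => ?_⟩
    have e1 : deriv ((fun x => c + A' x) ∘ γ) = fun t => A' (deriv γ t) := by
      ext1 t
      exact ((hd (γ t)).comp_hasDerivAt t
        (hγ.differentiable (by simp) t).hasDerivAt).deriv
    have e2 : deriv (fun t => A' (deriv γ t)) t = A (deriv (deriv γ) t) := by
      have : ContDiff ℝ ∞ (deriv γ) := (contDiff_infty_iff_deriv.1 hγ).2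
      exact (A'.hasFDerivAt.comp_hasDerivAt t
        (this.differentiable (by simp) t).hasDerivAt).deriv
    rw [e1, e2]
    -- Split `X = ξ + A Y` with `ξ ∈ L`. The acceleration lies in the range of `A`, so only `A Y`
    -- pairs with it, and the isometry reduces the claim to the geodesic `γ`.
    obtain ⟨ξ, hξ, _, ⟨Y, rfl⟩, rfl⟩ := Submodule.mem_sup.1
      ((hAr.symm ▸ (isCompl_orthogonal_of_le_spaceFormTangent hx₀ hL).sup_eq_top :
        L ⊔ LinearMap.range A = ⊤) ▸ Submodule.mem_top (x := X))
    rw [map_add, form_symm, horth _ ξ hξ, zero_add, hA]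
    refine hγg t Y fun hk => ?_
    have := hX hk
    rwa [Function.comp_apply, hc0 hk, zero_add, map_add, form_symm,
      show A' (γ t) = A (γ t) from rfl, horth _ ξ hξ, zero_add, hA] at this

end SpaceFormProduct

namespace SpaceFormProduct

/-! ### The normal bundle of an isometric immersion -/

section NormalBundle

variable {ℓ m : ℕ} {k : Fin ℓ → ℝ} {n : Fin ℓ → ℕ}

theorem prodForm_apply (X Y : ProdAmb k n) :
    prodForm k n X Y = ∑ j, form (k j) (n j) (X j) (Y j) := by
  simp [prodForm, LinearMap.sum_apply]

theorem prodForm_eq_of_eq_zero {i : Fin ℓ} {X : ProdAmb k n} (hX : ∀ j, j ≠ i → X j = 0)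
    (Y : ProdAmb k n) : prodForm k n X Y = form (k i) (n i) (X i) (Y i) := by
  rw [prodForm_apply, Finset.sum_eq_single i (fun j _ hj => by simp [hX j hj]) (by simp)]

theorem factorProj_apply_of_ne {i j : Fin ℓ} (h : j ≠ i) (X : ProdAmb k n) :
    factorProj k n i X j = 0 := by
  simp [factorProj, h]

theorem factorProj_eq_self {i : Fin ℓ} {X : ProdAmb k n} (hX : ∀ j, j ≠ i → X j = 0) :
    factorProj k n i X = X := by
  ext1 j
  by_cases h : j = i
  · subst h; simp [factorProj]
  · rw [hX j h, factorProj_apply_of_ne h]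

variable {M : Type*} [TopologicalSpace M] [ChartedSpace (EuclideanSpace ℝ (Fin m)) M]
  {f : M → ProdAmb k n} {p : M}

theorem normalPart_eq_self (hp : f p ∈ prodSpaceForm k n) (ξ : normalSpace m f p) :
    normalPart m f p ξ = ξ := by
  rw [normalPart, orthProj, dif_pos (isCompl_normalSpace (m := m) f p hp)]
  exact Submodule.projectionOnto_apply_left _ _

/-- The part of `Z` removed by the projection is orthogonal to every normal vector. This passes
between `α` and the ambient second derivative. -/
theorem prodForm_normalPart (hp : f p ∈ prodSpaceForm k n) (ξ : normalSpace m f p)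
    (Z : ProdAmb k n) : prodForm k n ξ (normalPart m f p Z) = prodForm k n ξ Z := by
  have hc := isCompl_normalSpace (m := m) f p hp
  obtain ⟨a, ha, b, hb, rfl⟩ := Submodule.mem_sup.1
    (hc.sup_eq_top ▸ Submodule.mem_top (x := Z) : Z ∈ normalSpace m f p ⊔ _)
  have hb0 : normalPart m f p b = 0 := by
    rw [normalPart, orthProj, dif_pos hc]
    exact (Submodule.projectionOnto_apply_eq_zero_iff hc).2 hb
  have ha0 : normalPart m f p a = ⟨a, ha⟩ := normalPart_eq_self hp ⟨a, ha⟩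
  have hξb : prodForm k n ξ b = 0 := hb ξ ξ.2
  rw [map_add, hb0, add_zero, ha0, map_add, hξb, add_zero]

/-- The subspace `𝒱_i` consists of the normal vectors which are tangent to the `i`-th factor. -/
theorem mem_kerIdSubT_iff (hp : f p ∈ prodSpaceForm k n) {i : Fin ℓ} {ξ : normalSpace m f p} :
    ξ ∈ kerIdSubT m f i p ↔ ∀ j, j ≠ i → (ξ : ProdAmb k n) j = 0 := by
  have h0 : ξ ∈ kerIdSubT m f i p ↔ normalPart m f p (factorProj k n i ξ) = ξ := by
    rw [kerIdSubT, LinearMap.mem_ker, LinearMap.sub_apply, sub_eq_zero, eq_comm]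
    rfl
  rw [h0]
  refine ⟨fun h => ?_, fun h => by rw [factorProj_eq_self h, normalPart_eq_self hp]⟩
  have h1 := prodForm_normalPart hp ξ (factorProj k n i ξ)
  -- `⟨Y, Y⟩ = ⟨ξ, Y⟩ = ⟨ξ, ξ⟩ - ⟨ξ, (π_i ξ)^⊥⟩ = 0`, and `Y` is tangent to the product, where the
  -- form is positive definite.
  set Y : ProdAmb k n := ξ - factorProj k n i ξ with hY
  have hYi : Y i = 0 := by simp [hY, factorProj]
  have hYj : ∀ j, j ≠ i → Y j = (ξ : ProdAmb k n) j := fun j hj => by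
    simp only [hY, Pi.sub_apply, factorProj_apply_of_ne hj, sub_zero]
  have h2 : prodForm k n Y Y = 0 := by
    have : prodForm k n Y Y = prodForm k n ξ Y := by
      rw [prodForm_apply, prodForm_apply]
      refine Finset.sum_congr rfl fun j _ => ?_
      by_cases hj : j = i
      · subst hj; simp [hYi]
      · rw [hYj j hj]
    rw [this, hY, map_sub, ← h1, h, sub_self]
  have hYT : Y ∈ prodTangent k n (f p) := fun j _ => by
    by_cases hj : j = i
    · subst hj; rw [hYi]; exact Submodule.zero_mem _
    · rw [hYj j hj]; exact ξ.2.1 j (Set.mem_univ j)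
  have hY0 : Y = 0 := by
    by_contra h
    exact (prodForm_pos k n _ hp Y hYT h).ne' h2
  intro j hj
  rw [← hYj j hj, hY0, Pi.zero_apply]

theorem diff_apply_eq_zero {σ : M → ProdAmb k n}
    (hσ : MDifferentiableAt (𝓡 m) 𝓘(ℝ, ProdAmb k n) σ p) {j : Fin ℓ} (h : ∀ q, σ q j = 0)
    (X : TangentSpace (𝓡 m) p) : diff m σ p X j = 0 := by
  have h1 := mfderiv_comp p
    (ContinuousLinearMap.proj (R := ℝ) (φ := fun j => Amb (k j) (n j)) j).mdifferentiableAt hσ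
  have h2 : (ContinuousLinearMap.proj (R := ℝ) (φ := fun j => Amb (k j) (n j)) j) ∘ σ =
      fun _ => 0 := funext h
  rw [h2, mfderiv_const, ContinuousLinearMap.mfderiv_eq] at h1
  exact (DFunLike.congr_fun h1 X).symm

/-- The scalar product of `ℝᴺ` as a continuous bilinear map. -/
noncomputable def prodFormL (k : Fin ℓ → ℝ) (n : Fin ℓ → ℕ) : ProdAmb k n →L[ℝ] ProdAmb k n →L[ℝ] ℝ :=
  LinearMap.toContinuousLinearMap (LinearMap.toContinuousLinearMap.toLinearMap ∘ₗ prodForm k n)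

theorem prodFormL_apply (X Y : ProdAmb k n) : prodFormL k n X Y = prodForm k n X Y := rfl

/-- `𝒱_i ∩ 𝒩₁^⊥` as a family of subspaces of `ℝᴺ`. -/
noncomputable def reductionSpace (m : ℕ) {M : Type*} [TopologicalSpace M]
    [ChartedSpace (EuclideanSpace ℝ (Fin m)) M] (f : M → ProdAmb k n) (i : Fin ℓ) (p : M) :
    Submodule ℝ (ProdAmb k n) :=
  (kerIdSubT m f i p ⊓ firstNormalSpacePerp m f p).map (normalSpace m f p).subtype

theorem mem_reductionSpace {i : Fin ℓ} {Z : ProdAmb k n} :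
    Z ∈ reductionSpace m f i p ↔ ∃ h : Z ∈ normalSpace m f p,
      (⟨Z, h⟩ : normalSpace m f p) ∈ kerIdSubT m f i p ⊓ firstNormalSpacePerp m f p := by
  constructor
  · rintro ⟨Z, hZ, rfl⟩
    exact ⟨Z.2, hZ⟩
  · rintro ⟨h, hZ⟩
    exact ⟨_, hZ, rfl⟩

variable [IsManifold (𝓡 m) ∞ M]

/-- Differentiating `⟨ξ, f_* Y⟩ = 0` for a normal field `ξ`. -/
theorem prodForm_diff_add_prodForm_secondDeriv (hf : ContMDiff (𝓡 m) 𝓘(ℝ, ProdAmb k n) ∞ f)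
    {σ : M → ProdAmb k n} (hσ : ContMDiff (𝓡 m) 𝓘(ℝ, ProdAmb k n) ∞ σ)
    (hn : ∀ q, σ q ∈ normalSpace m f q) (p : M) (X Y : EuclideanSpace ℝ (Fin m)) :
    prodForm k n (diff m σ p X) (diff m f p Y) + prodForm k n (σ p)
      (fderiv ℝ (fderiv ℝ (f ∘ (extChartAt (𝓡 m) p).symm)) (extChartAt (𝓡 m) p p) X Y) = 0 := by
  set φ := extChartAt (𝓡 m) p with hφ
  set F := f ∘ φ.symm
  set S := σ ∘ φ.symm
  have hu : φ p ∈ φ.target := mem_extChartAt_target p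
  have hF : ContDiffAt ℝ ∞ F (φ p) := contMDiffAt_comp_extChartAt_symm hu (hf _)
  have hS : ContDiffAt ℝ ∞ S (φ p) := contMDiffAt_comp_extChartAt_symm hu (hσ _)
  have hF' : HasFDerivAt (fderiv ℝ F) (fderiv ℝ (fderiv ℝ F) (φ p)) (φ p) :=
    ((hF.fderiv_right (m := 1) (by norm_cast)).differentiableAt (by simp)).hasFDerivAt
  have hS' : HasFDerivAt S (fderiv ℝ S (φ p)) (φ p) :=
    (hS.differentiableAt (by simp)).hasFDerivAt
  have hFY : HasFDerivAt (fun u => fderiv ℝ F u Y)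
      ((ContinuousLinearMap.apply ℝ (ProdAmb k n) Y).comp
        (fderiv ℝ (fderiv ℝ F) (φ p))) (φ p) :=
    (ContinuousLinearMap.apply ℝ (ProdAmb k n)
      Y).hasFDerivAt.comp (φ p) hF'
  -- Product rule in the chart for `⟨σ, f_* Y⟩`, with `Y` extended with constant components; this
  -- function vanishes on the chart target.
  have hB := (prodFormL k n).hasFDerivAt_of_bilinear hS' hFY
  have h0 : (fun u => prodFormL k n (S u) (fderiv ℝ F u Y)) =ᶠ[𝓝 (φ p)] fun _ => 0 := by
    filter_upwards [(isOpen_extChartAt_target (I := 𝓡 m) p).mem_nhds hu] with u hu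
    obtain ⟨Z, hZ⟩ := (exists_fderiv_comp_extChartAt_symm hu
      ((hf _).mdifferentiableAt (by simp))).2 Y
    rw [hZ]
    refine (prodForm_symm k n _ _).trans ?_
    exact (hn (φ.symm u)).2 _ ⟨Z, rfl⟩
  have h1 := DFunLike.congr_fun (hB.unique ((hasFDerivAt_const (0 : ℝ) (φ p)).congr_of_eventuallyEq
    h0)) X
  have hdf : (diff m f p : EuclideanSpace ℝ (Fin m) →L[ℝ] ProdAmb k n) = fderiv ℝ F (φ p) :=
    mfderiv_eq_fderiv_extChartAt ((hf p).mdifferentiableAt (by simp))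
  have hdσ : (diff m σ p : EuclideanSpace ℝ (Fin m) →L[ℝ] ProdAmb k n) = fderiv ℝ S (φ p) :=
    mfderiv_eq_fderiv_extChartAt ((hσ p).mdifferentiableAt (by simp))
  have hSp : S (φ p) = σ p := by simp [S, hφ]
  rw [add_comm, ← hSp]
  erw [hdf, hdσ]
  exact h1

/-! ### Parallelism of `𝒱_i ∩ 𝒩₁^⊥` in the ambient space -/

variable {g : Bundle.ContMDiffRiemannianMetric (𝓡 m) ∞ (EuclideanSpace ℝ (Fin m))
      (fun p : M => TangentSpace (𝓡 m) p)}

/-- The derivatives in `ℝᴺ` of a section of `𝒱_i` which is orthogonal to `𝒩₁` are normal to `f`. -/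
theorem diff_section_mem_normalSpace (hf : IsIsometricImmersion m g f) {i : Fin ℓ}
    {σ : M → ProdAmb k n} (hσ : ContMDiff (𝓡 m) 𝓘(ℝ, ProdAmb k n) ∞ σ)
    (hn : ∀ q, σ q ∈ normalSpace m f q) (hi : ∀ q j, j ≠ i → σ q j = 0) (p : M)
    (hperp : ∀ X Y, prodForm k n (σ p)
      (fderiv ℝ (fderiv ℝ (f ∘ (extChartAt (𝓡 m) p).symm)) (extChartAt (𝓡 m) p p) X Y) = 0)
    (X : TangentSpace (𝓡 m) p) : diff m σ p X ∈ normalSpace m f p := by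
  have hdσ : MDifferentiableAt (𝓡 m) 𝓘(ℝ, ProdAmb k n) σ p := (hσ p).mdifferentiableAt (by simp)
  have hdf : MDifferentiableAt (𝓡 m) 𝓘(ℝ, ProdAmb k n) f p :=
    (hf.smooth p).mdifferentiableAt (by simp)
  have hdi : ∀ j, j ≠ i → diff m σ p X j = 0 := fun j hj =>
    diff_apply_eq_zero hdσ (fun q => hi q j hj) X
  refine ⟨fun j _ => ?_, ?_⟩
  · by_cases hj : j = i
    · subst hj
      intro hk
      set φ := extChartAt (𝓡 m) p with hφ
      have hB := (prodFormL k n).hasFDerivAt_of_bilinear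
        ((contMDiffAt_comp_extChartAt_symm (mem_extChartAt_target p) (hσ _)).differentiableAt
          (by simp)).hasFDerivAt
        ((contMDiffAt_comp_extChartAt_symm (mem_extChartAt_target p)
          (hf.smooth _)).differentiableAt (by simp)).hasFDerivAt
      -- For `k j ≠ 0`, tangency of `σ` to the curved factor says `⟨σ, f⟩ = 0`, as the other
      -- components of `σ` vanish.
      have h0 : (fun u => prodFormL k n ((σ ∘ φ.symm) u) ((f ∘ φ.symm) u)) = fun _ => 0 := by
        funext u
        rw [prodFormL_apply, Function.comp_apply, Function.comp_apply,
          prodForm_eq_of_eq_zero (hi _), form_symm]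
        exact (hn (φ.symm u)).1 j (Set.mem_univ j) hk
      have h1 := DFunLike.congr_fun (hB.unique (h0 ▸ hasFDerivAt_const (0 : ℝ) (φ p))) X
      have h2 : prodForm k n (σ p) (diff m f p X) + prodForm k n (diff m σ p X) (f p) = 0 := by
        have e1 : (diff m f p : EuclideanSpace ℝ (Fin m) →L[ℝ] ProdAmb k n) =
          fderiv ℝ (f ∘ φ.symm) (φ p) := mfderiv_eq_fderiv_extChartAt hdf
        have e2 : (diff m σ p : EuclideanSpace ℝ (Fin m) →L[ℝ] ProdAmb k n) =
          fderiv ℝ (σ ∘ φ.symm) (φ p) := mfderiv_eq_fderiv_extChartAt hdσ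
        have e3 : (f ∘ φ.symm) (φ p) = f p := by simp [hφ]
        have e4 : (σ ∘ φ.symm) (φ p) = σ p := by simp [hφ]
        erw [← e3, ← e4, e1, e2]
        exact h1
      have h3 : prodForm k n (σ p) (diff m f p X) = 0 := by
        rw [prodForm_symm]; exact (hn p).2 _ ⟨X, rfl⟩
      rwa [h3, zero_add, prodForm_eq_of_eq_zero hdi, form_symm] at h2
    · rw [hdi j hj]; exact Submodule.zero_mem _
  · rintro _ ⟨Y, rfl⟩
    have h1 := prodForm_diff_add_prodForm_secondDeriv hf.smooth hσ hn p X Y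
    rw [show prodForm k n (σ p) _ = 0 from hperp X Y, add_zero, prodForm_symm] at h1
    exact h1

/-- If `∇^⊥ (𝒱_i ∩ 𝒩₁^⊥) ⊂ 𝒩₁^⊥`, then `𝒱_i ∩ 𝒩₁^⊥` is parallel in `ℝᴺ`. -/
theorem diff_section_mem_reductionSpace (hf : IsIsometricImmersion m g f) (i : Fin ℓ)
    (hpar : ∀ ξ : (∀ p, normalSpace m f p), IsSmoothSection m f ξ →
      (∀ p, ξ p ∈ kerIdSubT m f i p ⊓ firstNormalSpacePerp m f p) →
      ∀ (p : M) (X : TangentSpace (𝓡 m) p),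
        normalConnection m f ξ p X ∈ firstNormalSpacePerp m f p)
    {σ : M → ProdAmb k n} (hσ : ContMDiff (𝓡 m) 𝓘(ℝ, ProdAmb k n) ∞ σ)
    (hL : ∀ q, σ q ∈ reductionSpace m f i q) (p : M) (X : TangentSpace (𝓡 m) p) :
    diff m σ p X ∈ reductionSpace m f i p := by
  choose hn hL using fun q => mem_reductionSpace.1 (hL q)
  have hi : ∀ q j, j ≠ i → σ q j = 0 := fun q => (mem_kerIdSubT_iff (hf.mem q)).1 (hL q).1
  have hZ : diff m σ p X ∈ normalSpace m f p := by
    refine diff_section_mem_normalSpace hf hσ hn hi p (fun X Y => ?_) X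
    rw [← prodForm_normalPart (hf.mem p) ⟨σ p, hn p⟩, prodForm_symm]
    exact (hL p).2 _ (Submodule.subset_span ⟨X, Y, rfl⟩)
  refine mem_reductionSpace.2 ⟨hZ, (mem_kerIdSubT_iff (hf.mem p)).2 fun j hj =>
    diff_apply_eq_zero ((hσ p).mdifferentiableAt (by simp)) (fun q => hi q j hj) X, ?_⟩
  have h1 := hpar (fun q => ⟨σ q, hn q⟩) hσ hL p X
  -- The ambient derivative is already normal, so projecting it changes nothing.
  have h2 : normalConnection m f (fun q => ⟨σ q, hn q⟩) p X = ⟨diff m σ p X, hZ⟩ :=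
    normalPart_eq_self (hf.mem p) ⟨_, hZ⟩
  rwa [h2] at h1

/-- The scalar product of `f` with a constant normal vector is constant. -/
theorem prodForm_eq_of_forall_mem_normalSpace [PreconnectedSpace M]
    (hf : ContMDiff (𝓡 m) 𝓘(ℝ, ProdAmb k n) ∞ f) {ξ : ProdAmb k n}
    (hξ : ∀ q, ξ ∈ normalSpace m f q) (p q : M) :
    prodForm k n ξ (f p) = prodForm k n ξ (f q) := by
  have hd : ∀ q, MDifferentiableAt (𝓡 m) 𝓘(ℝ, ProdAmb k n) f q := fun q =>
    (hf q).mdifferentiableAt (by simp)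
  refine eq_of_mfderiv_eq_zero (m := m) (h := prodFormL k n ξ ∘ f)
    (fun q => (prodFormL k n ξ).mdifferentiableAt.comp q (hd q)) (fun q X => ?_) p q
  rw [mfderiv_comp q (prodFormL k n ξ).mdifferentiableAt (hd q), ContinuousLinearMap.mfderiv_eq]
  exact (prodForm_symm k n _ _).trans ((hξ q).2 _ ⟨X, rfl⟩)

end NormalBundle

end SpaceFormProduct

/-! ### Reduction of codimension -/

open SpaceFormProduct
theorem corollary4p3 {ℓ m : ℕ} (k : Fin ℓ → ℝ) (n : Fin ℓ → ℕ)
    {M : Type*} [TopologicalSpace M] [T2Space M] [ConnectedSpace M]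
    [ChartedSpace (EuclideanSpace ℝ (Fin m)) M] [IsManifold (𝓡 m) ∞ M]
    (g : Bundle.ContMDiffRiemannianMetric (𝓡 m) ∞ (EuclideanSpace ℝ (Fin m))
      (fun p : M => TangentSpace (𝓡 m) p))
    (f : M → ProdAmb k n) (hf : IsIsometricImmersion m g f)
    (i : Fin ℓ) (r : ℕ)
    (hL : IsSubbundle m f (fun p => kerIdSubT m f i p ⊓ firstNormalSpacePerp m f p) r)
    (hpar : ∀ ξ : (∀ p, normalSpace m f p), IsSmoothSection m f ξ →
      (∀ p, ξ p ∈ kerIdSubT m f i p ⊓ firstNormalSpacePerp m f p) →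
      ∀ (p : M) (X : TangentSpace (𝓡 m) p),
        normalConnection m f ξ p X ∈ firstNormalSpacePerp m f p) :
    CodimReduced f i r := by
  have hframe : ∀ p : M, ∃ U : Set M, IsOpen U ∧ p ∈ U ∧ ∃ s : Fin r → M → ProdAmb k n,
      (∀ a, ContMDiffOn (𝓡 m) 𝓘(ℝ, ProdAmb k n) ∞ (s a) U) ∧
      ∀ q ∈ U, LinearIndependent ℝ (fun a => s a q) ∧
        Submodule.span ℝ (Set.range fun a => s a q) = reductionSpace m f i q := by
    intro p
    obtain ⟨U, hU, hp, s, hs, hspan⟩ := hL p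
    refine ⟨U, hU, hp, fun a q => s a q, hs, fun q hq => ⟨?_, ?_⟩⟩
    · exact (hspan q hq).1.map' _ (Submodule.ker_subtype _)
    · have h : Submodule.span ℝ (Set.range fun a => s a q) =
        kerIdSubT m f i q ⊓ firstNormalSpacePerp m f q := (hspan q hq).2
      rw [reductionSpace, ← h, Submodule.map_span, ← Set.range_comp]
      rfl
  have hconst := subbundle_eq_of_mfderiv_mem (reductionSpace m f i) hframe
    fun σ hσ hσL q X => diff_section_mem_reductionSpace hf i hpar hσ hσL q X
  obtain ⟨p₀⟩ : Nonempty M := inferInstance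
  set Λ := reductionSpace m f i p₀ with hΛdef
  have hΛ : ∀ q, ∀ ξ ∈ Λ, ξ ∈ normalSpace m f q := fun q ξ hξ =>
    (mem_reductionSpace.1 (hconst p₀ q ▸ hΛdef ▸ hξ)).1
  have hΛi : ∀ ξ ∈ Λ, ∀ j, j ≠ i → ξ j = 0 := fun ξ hξ =>
    (mem_kerIdSubT_iff (hf.mem p₀)).1 (mem_reductionSpace.1 hξ).2.1
  have hrank : Module.finrank ℝ Λ = r := by
    obtain ⟨U, -, hp, s, -, hspan⟩ := hframe p₀
    have h := finrank_span_eq_card (hspan p₀ hp).1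
    rwa [(hspan p₀ hp).2, Fintype.card_fin] at h
  -- Vectors of `Λ` have only an `i`-th component, so this projection loses no dimension.
  set L := Λ.map (LinearMap.proj (R := ℝ) (φ := fun j => Amb (k j) (n j)) i)
  have hLrank : Module.finrank ℝ L = r := by
    rw [← hrank]
    have h := LinearMap.finrank_range_of_inj (f := (LinearMap.proj (R := ℝ)
      (φ := fun j => Amb (k j) (n j)) i).domRestrict Λ) fun ξ η h => Subtype.ext <|
        funext fun j => by
        by_cases hj : j = i
        · subst hj; exact h
        · rw [hΛi ξ ξ.2 j hj, hΛi η η.2 j hj]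
    rwa [LinearMap.range_domRestrict] at h
  have hLT : L ≤ spaceFormTangent (k i) (n i) (f p₀ i) := by
    rintro _ ⟨ξ, hξ, rfl⟩
    exact (hΛ p₀ ξ hξ).1 i (Set.mem_univ i)
  obtain ⟨m', hm', hS⟩ := isTotallyGeodesic_orthogonal (hf.mem p₀ i) hLT
  refine ⟨m', _, by rwa [hLrank] at hm', hS, fun p => ⟨hf.mem p i, ?_⟩⟩
  rintro _ ⟨ξ, hξ, rfl⟩
  have h := prodForm_eq_of_forall_mem_normalSpace hf.smooth (fun q => hΛ q ξ hξ) p p₀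
  rwa [prodForm_eq_of_eq_zero (hΛi ξ hξ), prodForm_eq_of_eq_zero (hΛi ξ hξ)] at h
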